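/- **Setting.** Let $V$ be a finite set and, for each $v\in V$, let $\mathcal X_v$ be a measurable space with at least two elements in which singletons are measurable. For $I\subseteq V$ put $\mathcal X_I=\prod_{v\in I}\mathcal X_v$, $\mathcal X=\mathcal X_V$, and for $x\in\mathcal X$ let $x_I$ denote its restriction to $I$. *Graphs.* A PDAG on $V$ is a simple graph (at most one edge between two vertices, no self-loops) with directed edges $a\to b$ and undirected edges $a-b$, without directed cycles; a DAG is a PDAG with only directed edges. The skeleton of a PDAG forgets edge types; $\mathrm{Pa}_{\mathcal D}(v)$ is the set of parents of $v$ in $\mathcal D$; a v-structure is a configuration $a\to b\leftarrow c$ with $a\ne c$ non-adjacent. A PDAG $\mathcal G$ is an MPDAG if (i) for each connected component $C$ of the graph formed by its undirected edges, the skeleton of the induced subgraph $\mathcal G_C$ is chordal, and (ii) none of the following occurs as an induced subgraph: $a\to b-c$ with $a,c$ non-adjacent; $a\to b\to c$ with $a-c$; $a-b$, $a-c$, $a-d$, $c\to b$, $d\to b$ with $c\neq d$ non-adjacent; $a-b$, $a-c$, $a-d$, $d\to c\to b$ with $b,d$ non-adjacent. A DAG $\mathcal D$ is represented by $\mathcal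 G$ if it is obtained by orienting the undirected edges of $\mathcal G$ without introducing directed cycles or v-structures that are not already v-structures of $\mathcal G$. *Causal models.* A potential outcome schedule is a family $X(\cdot)=(X_v(x_I): v\in V,\ I\subseteq V,\ x_I\in\mathcal X_I)$ of random variables with $X_v(x_I)\in\mathcal X_v$; its law $P$ is a probability measure on the product of these spaces with the product $\sigma$-algebra. Let $\mathcal M^{\mathrm c}$ be the set of consistent laws: for all disjoint $I,I'\subseteq V$ and all $x\in\mathcal X$, $P$-almost surely, $X_{I'}(x_I)=x_{I'}$ implies $X(x_I,x_{I'})=X(x_I)$. For a DAG $\mathcal D$, let $\mathcal M_{\mathrm{dag}}(\mathcal D)$ be the set of $P\in\mathcal M^{\mathrm c}$ such that 1. for all $v\in V$, $I\subseteq V$, $x\in\mathcal X$: $X_v(x_I)=X_v(x_{I\cap \mathrm{Pa}_{\mathcal D}(v)})$ $P$-almost surely; 2. for all $x\in\mathcal X$, the variables $X_v(x_{\mathrm{Pa}_{\mathcal D}(v)})$, $v\in V$, are mutually independent under $P$. For an MPDAG $\mathcal G$, let $\mathcal M(\mathcal G)=\bigcup\{\mathcal M_{\mathrm{dag}}(\mathcal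 D):\mathcal D\text{ is a DAG represented by }\mathcal G\}$. **Proposition.** Let $\mathcal G_1,\mathcal G_2$ be two MPDAGs on $V$. Then $\mathcal M(\mathcal G_1)\subseteq\mathcal M(\mathcal G_2)$ if and only if for every DAG $\mathcal D_1$ represented by $\mathcal G_1$ there exists a DAG $\mathcal D_2$ represented by $\mathcal G_2$ such that $\mathcal D_1$ is a directed subgraph of $\mathcal D_2$ (every edge $a\to b$ of $\mathcal D_1$ is an edge $a\to b$ of $\mathcal D_2$). -/

import Mathlib

open MeasureTheory ProbabilityTheory

universe u w

/-! ## Partially directed graphs -/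

/-- A partially directed acyclic graph on the vertex set `V`: a simple graph (at most one edge, of
either type, between two vertices, no self-loops) with directed edges `dir a b` (`a → b`) and
undirected edges `und a b` (`a - b`), and without directed cycles. -/
structure PDAG (V : Type u) where
  dir : V → V → Prop
  und : V → V → Prop
  und_symm : ∀ a b, und a b → und b a
  und_irrefl : ∀ a, ¬ und a a
  simple : ∀ a b, dir a b → ¬ und a b
  /-- no directed path of positive length returns to its start; in particular there are no directed
  self-loops and no pairs `a → b`, `b → a` -/
  acyclic : ∀ a, ¬ Relation.TransGen dir a a

/-- A directed acyclic graph is a PDAG all of whose edges are directed. -/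
structure DAG (V : Type u) extends PDAG V where
  no_und : ∀ a b, ¬ und a b

namespace PDAG

variable {V : Type u}

/-- There is an edge of some type between `a` and `b`. -/
def Adj (G : PDAG V) (a b : V) : Prop := G.dir a b ∨ G.dir b a ∨ G.und a b

/-- The skeleton: forget the types and directions of all edges. -/
def skeleton (G : PDAG V) : SimpleGraph V where
  Adj := G.Adj
  symm := ⟨by
    rintro a b (h | h | h)
    · exact Or.inr (Or.inl h)
    · exact Or.inl h
    · exact Or.inr (Or.inr (G.und_symm _ _ h))⟩
  loopless := ⟨by
    rintro a (h | h | h)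
    · exact G.acyclic a (Relation.TransGen.single h)
    · exact G.acyclic a (Relation.TransGen.single h)
    · exact G.und_irrefl a h⟩

/-- The undirected graph formed by the undirected edges alone. -/
def undGraph (G : PDAG V) : SimpleGraph V where
  Adj := G.und
  symm := ⟨fun a b h => G.und_symm a b h⟩
  loopless := ⟨fun a h => G.und_irrefl a h⟩

/-- The parents of `v`. -/
def parents (G : PDAG V) (v : V) : Set V := {a | G.dir a v}

/-- `G₁` is a subgraph of `G₂`: containment of edge sets for each edge type. -/
def IsSubgraph (G₁ G₂ : PDAG V) : Prop :=
  (∀ a b, G₁.dir a b → G₂.dir a b) ∧ (∀ a b, G₁.und a b → G₂.und a b)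

/-- `a → b ← c` is a v-structure (unshielded collider). -/
def IsVStructure (G : PDAG V) (a b c : V) : Prop :=
  G.dir a b ∧ G.dir c b ∧ a ≠ c ∧ ¬ G.Adj a c

end PDAG

/-- Every cycle of length at least four has a chord: an edge between two of its vertices that are
not consecutive on the cycle. -/
def SimpleGraph.HasChords {V : Type u} (H : SimpleGraph V) : Prop :=
  ∀ (v : V) (c : H.Walk v v), c.IsCycle → 4 ≤ c.length →
    ∃ a ∈ c.support, ∃ b ∈ c.support, H.Adj a b ∧ s(a, b) ∉ c.edges

/-- A PDAG is a valid maximally oriented PDAG if, for each connected component of its undirected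
edges, the skeleton of the subgraph induced on that component is chordal, and none of the four
configurations to which Meek's orientation rules apply occurs as an induced subgraph. -/
structure PDAG.IsMPDAG {V : Type u} (G : PDAG V) : Prop where
  chordal : ∀ C : G.undGraph.ConnectedComponent, (G.skeleton.induce C.supp).HasChords
  /-- not `a → b - c` with `a`, `c` non-adjacent -/
  meek1 : ∀ a b c, ¬ (G.dir a b ∧ G.und b c ∧ ¬ G.Adj a c)
  /-- not `a → b → c` with `a - c` -/
  meek2 : ∀ a b c, ¬ (G.dir a b ∧ G.dir b c ∧ G.und a c)
  /-- not `a - b`, `a - c`, `a - d`, `c → b`, `d → b` with `c`, `d` distinct and non-adjacent -/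
  meek3 : ∀ a b c d, ¬ (G.und a b ∧ G.und a c ∧ G.und a d ∧ G.dir c b ∧ G.dir d b ∧
    c ≠ d ∧ ¬ G.Adj c d)
  /-- not `a - b`, `a - c`, `a - d`, `d → c → b` with `b`, `d` non-adjacent -/
  meek4 : ∀ a b c d, ¬ (G.und a b ∧ G.und a c ∧ G.und a d ∧ G.dir d c ∧ G.dir c b ∧
    ¬ G.Adj b d)

/-- `D` is represented by `G`: it is a DAG obtained by orienting the undirected edges of `G` without
introducing directed cycles (part of the type of `D`) or new v-structures. -/
structure PDAG.Represents {V : Type u} (G : PDAG V) (D : DAG V) : Prop where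
  adj_iff : ∀ a b, D.toPDAG.Adj a b ↔ G.Adj a b
  dir_of_dir : ∀ a b, G.dir a b → D.dir a b
  vStructure : ∀ a b c, D.toPDAG.IsVStructure a b c → G.IsVStructure a b c

/-! ## Potential outcome schedules and causal models -/

section Causal

variable {V : Type u} (𝒳 : V → Type w)

/-- An intervention: a set `I` of vertices together with a value `x_I` imposed on `X_I`. -/
abbrev Intervention : Type (max u w) := Σ I : Set V, ∀ i : I, 𝒳 i

/-- The value space of the potential outcome schedule `(X_v(x_I))`, equipped with the product
σ-algebra: a point `ω` gives the vector `(ω ⟨I, x_I⟩ v)_v` for each intervention. -/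
abbrev Schedule : Type (max u w) := Intervention 𝒳 → ∀ v, 𝒳 v

variable {𝒳}

/-- The random variable `X_v(x_I)`, where `x_I` is the restriction of `x` to `I`. -/
def potentialOutcome (x : ∀ v, 𝒳 v) (I : Set V) (v : V) (ω : Schedule 𝒳) : 𝒳 v :=
  ω ⟨I, fun i => x i⟩ v

variable [∀ v, MeasurableSpace (𝒳 v)]

/-- Consistency: `P (X(x_I, x_I') = X(x_I) | X_I'(x_I) = x_I') = 1` for all disjoint `I`, `I'` and
all `x`. For each fixed `I`, `I'`, `x` this says that almost surely the conditioning event implies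
the equality (so nothing is required when the conditioning event is null). -/
def IsConsistent (P : Measure (Schedule 𝒳)) : Prop :=
  ∀ (I I' : Set V), Disjoint I I' → ∀ x : ∀ v, 𝒳 v, ∀ᵐ ω ∂P,
    (∀ i ∈ I', potentialOutcome x I i ω = x i) →
      ∀ v, potentialOutcome x (I ∪ I') v ω = potentialOutcome x I v ω

/-- `P` is causal Markov with respect to `D`. -/
structure IsCausalMarkov (P : Measure (Schedule 𝒳)) (D : DAG V) : Prop where
  /-- `X_v(x_I) = X_v(x_{I ∩ Pa(v)})` almost surely -/
  exclusion : ∀ (v : V) (I : Set V) (x : ∀ v, 𝒳 v), ∀ᵐ ω ∂P,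
    potentialOutcome x I v ω = potentialOutcome x (I ∩ D.toPDAG.parents v) v ω
  /-- the one-step-ahead counterfactuals `X_v(x_{Pa(v)})`, `v ∈ V`, are mutually independent -/
  indep : ∀ x : ∀ v, 𝒳 v,
    iIndepFun (fun v => potentialOutcome x (D.toPDAG.parents v) v) P

variable (𝒳)

/-- The ground causal model: all consistent laws of the potential outcome schedule. -/
def groundCausalModel : Set (Measure (Schedule 𝒳)) :=
  {P | IsProbabilityMeasure P ∧ IsConsistent P}

/-- The causal model of a DAG. -/
def dagModel (D : DAG V) : Set (Measure (Schedule 𝒳)) :=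
  {P | P ∈ groundCausalModel 𝒳 ∧ IsCausalMarkov P D}

/-- The causal model of an MPDAG: the union of the models of the DAGs it represents. -/
def mpdagModel (G : PDAG V) : Set (Measure (Schedule 𝒳)) :=
  ⋃ D ∈ {D : DAG V | G.Represents D}, dagModel 𝒳 D

end Causal

/-! ## Monotonicity of the causal models of DAGs, and measurability of potential outcomes -/

section CausalBasics

variable {V : Type u} {𝒳 : V → Type w} [∀ v, MeasurableSpace (𝒳 v)]

/-! Adding edges to a DAG only weakens its causal Markov conditions, so DAG models are monotone
under directed subgraphs; taking unions gives one implication. For the converse, every DAG `D` has a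
law in its model that belongs to the model of `D'` only if `D` is a subgraph of `D'`. Applied to a
represented `D₁`, membership of this law in the union for `G₂` provides one `D₂` containing all
edges of `D₁` at once. The law is `singleEdgeLaw`: a uniformly random pair of vertices, or none, is
selected, and only that pair, if an edge of `D`, transmits an effect. Effects never propagate along
paths, which makes consistency easy; xor with fair coins gives independence; and each edge is active
with positive probability, so no edge can be dropped. -/

theorem IsCausalMarkov.mono {P : Measure (Schedule 𝒳)} {D₁ D₂ : DAG V}
    (h : IsCausalMarkov P D₁) (hD : D₁.toPDAG.IsSubgraph D₂.toPDAG) : IsCausalMarkov P D₂ := by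
  have hpa : ∀ v, D₁.toPDAG.parents v ⊆ D₂.toPDAG.parents v := fun v a ha => hD.1 a v ha
  constructor
  · intro v I x
    filter_upwards [h.exclusion v I x, h.exclusion v (I ∩ D₂.toPDAG.parents v) x] with ω h1 h2
    rw [h1, h2, Set.inter_assoc, Set.inter_eq_right.2 (hpa v)]
  · intro x
    -- Exclusion for `D₁` shows that the variables for the two parent sets agree almost surely.
    refine (h.indep x).congr fun v => ?_
    filter_upwards [h.exclusion v (D₂.toPDAG.parents v) x] with ω h1
    rw [h1, Set.inter_eq_right.2 (hpa v)]

theorem dagModel_mono {D₁ D₂ : DAG V} (hD : D₁.toPDAG.IsSubgraph D₂.toPDAG) :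
    dagModel 𝒳 D₁ ⊆ dagModel 𝒳 D₂ :=
  fun _ hP => ⟨hP.1, hP.2.mono hD⟩

theorem measurable_potentialOutcome (x : ∀ v, 𝒳 v) (I : Set V) (v : V) :
    Measurable (potentialOutcome x I v) :=
  (measurable_pi_apply v).comp (measurable_pi_apply _)

end CausalBasics

/-! ## Fair coins -/

section Coin

/-- The law of a fair coin. -/
noncomputable def fairCoin : Measure Bool := (PMF.uniformOfFintype Bool).toMeasure

instance : IsProbabilityMeasure fairCoin := by unfold fairCoin; infer_instance

theorem fairCoin_singleton (b : Bool) : fairCoin {b} = 2⁻¹ := by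
  rw [fairCoin, PMF.toMeasure_apply_singleton _ _ (measurableSet_singleton b)]
  simp

theorem measurePreserving_xor_fairCoin (c : Bool) :
    MeasurePreserving (fun b => xor b c) fairCoin fairCoin := by
  refine ⟨measurable_of_countable _, Measure.ext_of_singleton fun b => ?_⟩
  rw [Measure.map_apply (measurable_of_countable _) (measurableSet_singleton b)]
  have : (fun b => xor b c) ⁻¹' {b} = {xor b c} := by
    ext a
    cases a <;> cases b <;> cases c <;> simp
  rw [this, fairCoin_singleton, fairCoin_singleton]

theorem iIndepFun_of_measurePreserving {ι Ω Ω' : Type*} {β : ι → Type*} [MeasurableSpace Ω]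
    [MeasurableSpace Ω'] [∀ i, MeasurableSpace (β i)] {μ : Measure Ω} {μ' : Measure Ω'}
    {T : Ω → Ω'} (hT : MeasurePreserving T μ μ') {f : ∀ i, Ω' → β i}
    (hf : ∀ i, Measurable (f i)) :
    iIndepFun f μ' ↔ iIndepFun (fun i => f i ∘ T) μ := by
  have key : ∀ (S : Finset ι) (s : ∀ i, Set (β i)), (∀ i ∈ S, MeasurableSet (s i)) →
      μ' (⋂ i ∈ S, f i ⁻¹' s i) = μ (⋂ i ∈ S, (f i ∘ T) ⁻¹' s i) := by
    intro S s hs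
    rw [← hT.measure_preimage
      (Finset.measurableSet_biInter S fun i hi => hf i (hs i hi)).nullMeasurableSet]
    simp only [Set.preimage_iInter, Set.preimage_comp]
  have key' : ∀ (i : ι) (s : Set (β i)), MeasurableSet s →
      μ' (f i ⁻¹' s) = μ ((f i ∘ T) ⁻¹' s) := fun i s hs => by
    rw [← hT.measure_preimage (hf i hs).nullMeasurableSet, Set.preimage_comp]
  rw [iIndepFun_iff_measure_inter_preimage_eq_mul, iIndepFun_iff_measure_inter_preimage_eq_mul]
  refine forall_congr' fun S => forall_congr' fun s => forall_congr' fun hs => ?_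
  rw [key S s hs, Finset.prod_congr rfl fun i hi => key' i (s i) (hs i hi)]

/-- Coins flipped according to an independent random variable remain mutually independent. -/
theorem iIndepFun_xor_fairCoin {V E : Type*} [Fintype V] [MeasurableSpace E] [Countable E]
    [MeasurableSingletonClass E] (ν : Measure E) [IsProbabilityMeasure ν] (c : V → E → Bool) :
    iIndepFun (fun v (z : E × (V → Bool)) => xor (z.2 v) (c v z.1))
      (ν.prod (Measure.pi fun _ : V => fairCoin)) := by
  -- This shear preserves the product measure because, for each fixed `e`, it flips fair coins by
  -- constants. The variables in question are coin coordinates composed with it.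
  have hT : MeasurePreserving (fun z : E × (V → Bool) => (z.1, fun v => xor (z.2 v) (c v z.1)))
      (ν.prod (Measure.pi fun _ : V => fairCoin)) (ν.prod (Measure.pi fun _ : V => fairCoin)) :=
    MeasurePreserving.skew_product (f := id)
      (g := fun e (ε : V → Bool) v => xor (ε v) (c v e))
      (MeasurePreserving.id ν) (measurable_of_countable _) (Filter.Eventually.of_forall fun e =>
        (measurePreserving_pi _ _ fun v => measurePreserving_xor_fairCoin (c v e)).map_eq)
  have h := iIndepFun_pi (μ := fun _ : V => fairCoin) (X := fun _ b => b)
    fun _ => aemeasurable_id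
  rw [iIndepFun_of_measurePreserving (measurePreserving_snd.comp hT)
    fun v => measurable_pi_apply v] at h
  exact h

end Coin

/-! ## A law whose only causal effects are the edges of a given DAG

At most one randomly chosen edge of the DAG is active. Every vertex has a fair coin, and its value
is determined by that coin, flipped according to the current value of the tail if the vertex is the
head of the active edge. -/

/-- The selected pair of vertices, if any. -/
abbrev EdgeChoice (V : Type u) : Type u := Option (V × V)

instance (V : Type u) : MeasurableSpace (EdgeChoice V) := ⊤

instance (V : Type u) : DiscreteMeasurableSpace (EdgeChoice V) := ⟨fun _ => trivial⟩

section SingleEdge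

variable {V : Type u} {𝒳 : V → Type w}

open Classical in
/-- Under intervention `i`, the value of `a` is the distinguished value `p a`; without intervention
on `a` this is decided by the coin of `a`. -/
def CurrentBit (p : ∀ v, 𝒳 v) (ε : V → Bool) (i : Intervention 𝒳) (a : V) : Prop :=
  if h : a ∈ i.1 then i.2 ⟨a, h⟩ = p a else ε a = true

/-- `v` is the head of the active edge, and the current value of the tail flips the coin of `v`. -/
def IsFlipped (D : DAG V) (p : ∀ v, 𝒳 v) (z : EdgeChoice V × (V → Bool))
    (i : Intervention 𝒳) (v : V) : Prop :=
  ∃ a, z.1 = some (a, v) ∧ D.dir a v ∧ CurrentBit p z.2 i a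

open Classical in
/-- The schedule in which at most one edge is active. -/
noncomputable def singleEdgeSchedule (D : DAG V) (p q : ∀ v, 𝒳 v)
    (z : EdgeChoice V × (V → Bool)) : Schedule 𝒳 :=
  fun i v => if xor (z.2 v) (decide (IsFlipped D p z i v)) then p v else q v

theorem currentBit_of_mem {p x : ∀ v, 𝒳 v} {ε : V → Bool} {I : Set V} {a : V} (ha : a ∈ I) :
    CurrentBit p ε ⟨I, fun i => x i⟩ a ↔ x a = p a := by
  simp [CurrentBit, ha]

theorem currentBit_of_notMem {p x : ∀ v, 𝒳 v} {ε : V → Bool} {I : Set V} {a : V} (ha : a ∉ I) :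
    CurrentBit p ε ⟨I, fun i => x i⟩ a ↔ ε a = true := by
  simp [CurrentBit, ha]

theorem currentBit_congr {p x : ∀ v, 𝒳 v} {ε : V → Bool} {I J : Set V} {a : V}
    (ha : a ∈ I ↔ a ∈ J) :
    CurrentBit p ε ⟨I, fun i => x i⟩ a ↔ CurrentBit p ε ⟨J, fun i => x i⟩ a := by
  by_cases h : a ∈ I
  · rw [currentBit_of_mem h, currentBit_of_mem (ha.1 h)]
  · rw [currentBit_of_notMem h, currentBit_of_notMem (mt ha.2 h)]

variable (D : DAG V) {p q : ∀ v, 𝒳 v}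

theorem singleEdgeSchedule_mem (z : EdgeChoice V × (V → Bool)) (i : Intervention 𝒳) (v : V) :
    singleEdgeSchedule D p q z i v = p v ∨ singleEdgeSchedule D p q z i v = q v := by
  unfold singleEdgeSchedule
  split_ifs <;> simp

/-- An intervention enters only through the current bit of the tail of the active edge. -/
theorem singleEdgeSchedule_congr {z : EdgeChoice V × (V → Bool)} {i j : Intervention 𝒳} {v : V}
    (h : ∀ a, z.1 = some (a, v) → D.dir a v →
      (CurrentBit p z.2 i a ↔ CurrentBit p z.2 j a)) :
    singleEdgeSchedule D p q z i v = singleEdgeSchedule D p q z j v := by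
  have : IsFlipped D p z i v = IsFlipped D p z j v := propext <|
    exists_congr fun a => and_congr_right fun h1 => and_congr_right fun h2 => h a h1 h2
  unfold singleEdgeSchedule
  rw [this]

theorem singleEdgeSchedule_exclusion (z : EdgeChoice V × (V → Bool)) (v : V) (I : Set V)
    (x : ∀ v, 𝒳 v) :
    potentialOutcome x I v (singleEdgeSchedule D p q z) =
      potentialOutcome x (I ∩ D.toPDAG.parents v) v (singleEdgeSchedule D p q z) :=
  singleEdgeSchedule_congr D fun _ _ h2 => currentBit_congr ⟨fun h => ⟨h, h2⟩, fun h => h.1⟩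

/-- The case that matters is an active tail `a` in `I'` but not in `I`. As `a` is not the head of
the active edge, its value under `x_I` is decided by its own coin, so imposing that same value
leaves its current bit unchanged. -/
theorem singleEdgeSchedule_consistent (hpq : ∀ v, p v ≠ q v) (z : EdgeChoice V × (V → Bool))
    (I I' : Set V) (x : ∀ v, 𝒳 v)
    (h : ∀ i ∈ I', potentialOutcome x I i (singleEdgeSchedule D p q z) = x i) (v : V) :
    potentialOutcome x (I ∪ I') v (singleEdgeSchedule D p q z) =
      potentialOutcome x I v (singleEdgeSchedule D p q z) := by
  refine singleEdgeSchedule_congr D fun a h1 h2 => ?_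
  by_cases hI : a ∈ I
  · exact currentBit_congr ⟨fun _ => hI, Or.inl⟩
  by_cases hI' : a ∈ I'
  · rw [currentBit_of_mem (Set.mem_union_right I hI'), currentBit_of_notMem hI, ← h a hI']
    have hav : a ≠ v := by
      rintro rfl
      exact D.acyclic a (Relation.TransGen.single h2)
    have hflip : ¬ IsFlipped D p z ⟨I, fun i => x i⟩ a := by
      rintro ⟨b, hb, -⟩
      rw [h1, Option.some_inj, Prod.mk.injEq] at hb
      exact hav hb.2.symm
    simp [potentialOutcome, singleEdgeSchedule, hflip, (hpq a).symm]
  · exact currentBit_congr ⟨fun h => h.elim id fun h => absurd h hI', Or.inl⟩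

/-- Intervening on the tail of an edge has an effect on its head. -/
theorem singleEdgeSchedule_effect (hpq : ∀ v, p v ≠ q v) {a v : V} (hav : D.dir a v) :
    potentialOutcome p {a} v (singleEdgeSchedule D p q (some (a, v), fun _ => false)) ≠
      potentialOutcome p ∅ v (singleEdgeSchedule D p q (some (a, v), fun _ => false)) := by
  have h1 : IsFlipped D p (some (a, v), fun _ => false) ⟨{a}, fun i => p i⟩ v :=
    ⟨a, rfl, hav, (currentBit_of_mem rfl).2 rfl⟩
  have h2 : ¬ IsFlipped D p (some (a, v), fun _ => false) ⟨∅, fun i => p i⟩ v := by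
    rintro ⟨b, -, -, hb⟩
    rw [currentBit_of_notMem (Set.notMem_empty b)] at hb
    exact Bool.false_ne_true hb
  simp [potentialOutcome, singleEdgeSchedule, h1, h2, hpq v]

variable [Fintype V] [∀ v, MeasurableSpace (𝒳 v)]

variable (V) in
/-- The law of the selected pair and the coins. -/
noncomputable def edgeCoinMeasure : Measure (EdgeChoice V × (V → Bool)) :=
  (PMF.uniformOfFintype (EdgeChoice V)).toMeasure.prod (Measure.pi fun _ => fairCoin)

instance : IsProbabilityMeasure (edgeCoinMeasure V) := by
  unfold edgeCoinMeasure; infer_instance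

theorem edgeCoinMeasure_singleton_ne_zero (z : EdgeChoice V × (V → Bool)) :
    edgeCoinMeasure V {z} ≠ 0 := by
  rw [edgeCoinMeasure, ← Prod.mk.eta (p := z), ← Set.singleton_prod_singleton, Measure.prod_prod,
    PMF.toMeasure_apply_singleton _ _ (measurableSet_singleton z.1), Measure.pi_singleton]
  simp only [PMF.uniformOfFintype_apply, fairCoin_singleton]
  exact mul_ne_zero (ENNReal.inv_ne_zero.2 (ENNReal.natCast_ne_top _))
    (Finset.prod_ne_zero_iff.2 fun _ _ => ENNReal.inv_ne_zero.2 ENNReal.ofNat_ne_top)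

/-- Every point is an atom. -/
theorem forall_of_ae_edgeCoinMeasure {r : EdgeChoice V × (V → Bool) → Prop}
    (h : ∀ᵐ z ∂edgeCoinMeasure V, r z) (z : EdgeChoice V × (V → Bool)) : r z := by
  by_contra hz
  exact edgeCoinMeasure_singleton_ne_zero z
    (measure_mono_null (Set.singleton_subset_iff.2 hz) (ae_iff.1 h))

theorem measurable_singleEdgeSchedule : Measurable (singleEdgeSchedule D p q) :=
  measurable_of_countable _

variable (p q) in
/-- The law of the schedule in which at most one edge is active. -/
noncomputable def singleEdgeLaw : Measure (Schedule 𝒳) :=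
  (edgeCoinMeasure V).map (singleEdgeSchedule D p q)

theorem measurePreserving_singleEdgeSchedule :
    MeasurePreserving (singleEdgeSchedule D p q) (edgeCoinMeasure V) (singleEdgeLaw D p q) :=
  ⟨measurable_singleEdgeSchedule D, rfl⟩

theorem ae_singleEdgeLaw_of_measurableSet {s : Set (Schedule 𝒳)} (hs : MeasurableSet s)
    (h : ∀ z, singleEdgeSchedule D p q z ∈ s) : ∀ᵐ ω ∂singleEdgeLaw D p q, ω ∈ s :=
  (ae_map_iff (measurable_singleEdgeSchedule D).aemeasurable hs).2 (Filter.Eventually.of_forall h)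

/-- If `a → v` were missing from `D'`, exclusion would forbid any effect of intervening on `a`
alone; the atom where this edge is active and all coins are false shows one. -/
theorem isSubgraph_of_isCausalMarkov_singleEdgeLaw (hpq : ∀ v, p v ≠ q v) {D' : DAG V}
    (h : IsCausalMarkov (singleEdgeLaw D p q) D') : D.toPDAG.IsSubgraph D'.toPDAG := by
  refine ⟨fun a v hav => ?_, fun a b hab => absurd hab (D.no_und a b)⟩
  by_contra hav'
  have hempty : {a} ∩ D'.toPDAG.parents v = ∅ := Set.singleton_inter_eq_empty.2 hav'
  have hex := h.exclusion v {a} p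
  rw [hempty] at hex
  exact singleEdgeSchedule_effect D hpq hav (forall_of_ae_edgeCoinMeasure
    (ae_of_ae_map (measurable_singleEdgeSchedule D).aemeasurable hex) _)

variable [∀ v, MeasurableSingletonClass (𝒳 v)]

/-- An implication between an event and an equality of outcomes that holds for all values of the
selected pair and the coins holds almost surely. Outcomes take two values only, so the
diagonal of `𝒳 v` need not be measurable. -/
theorem ae_potentialOutcome_eq {x : ∀ v, 𝒳 v} {I J : Set V} {v : V} {s : Set (Schedule 𝒳)}
    (hs : MeasurableSet s) (h : ∀ z, singleEdgeSchedule D p q z ∈ s →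
      potentialOutcome x I v (singleEdgeSchedule D p q z) =
        potentialOutcome x J v (singleEdgeSchedule D p q z)) :
    ∀ᵐ ω ∂singleEdgeLaw D p q, ω ∈ s → potentialOutcome x I v ω = potentialOutcome x J v ω := by
  have hm : ∀ (K : Set V) (b : 𝒳 v), MeasurableSet (potentialOutcome x K v ⁻¹' {b}) :=
    fun K b => measurable_potentialOutcome x K v (measurableSet_singleton b)
  -- Equality is replaced by the measurable event that both outcomes are `p v` or both are `q v`.
  have := ae_singleEdgeLaw_of_measurableSet D (p := p) (q := q)
    (s := sᶜ ∪ (potentialOutcome x I v ⁻¹' {p v} ∩ potentialOutcome x J v ⁻¹' {p v} ∪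
      potentialOutcome x I v ⁻¹' {q v} ∩ potentialOutcome x J v ⁻¹' {q v}))
    (hs.compl.union (((hm I _).inter (hm J _)).union ((hm I _).inter (hm J _)))) fun z => by
      by_cases hz : singleEdgeSchedule D p q z ∈ s
      · have hJ := singleEdgeSchedule_mem D (p := p) (q := q) z ⟨J, fun i => x i⟩ v
        refine Or.inr (hJ.imp (fun hJ => ⟨?_, hJ⟩) (fun hJ => ⟨?_, hJ⟩)) <;>
        exact (h z hz).trans hJ
      · exact Or.inl hz
  filter_upwards [this] with ω hω hωs
  rcases hω with hω | hω | hω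
  · exact absurd hωs hω
  · exact hω.1.trans hω.2.symm
  · exact hω.1.trans hω.2.symm

theorem isConsistent_singleEdgeLaw (hpq : ∀ v, p v ≠ q v) :
    IsConsistent (singleEdgeLaw D p q) := by
  intro I I' _ x
  have hs : MeasurableSet {ω : Schedule 𝒳 | ∀ i ∈ I', potentialOutcome x I i ω = x i} := by
    have : {ω : Schedule 𝒳 | ∀ i ∈ I', potentialOutcome x I i ω = x i} =
        ⋂ i ∈ I', potentialOutcome x I i ⁻¹' {x i} := by
      ext ω
      simp
    rw [this]
    exact MeasurableSet.biInter I'.to_countable fun i _ =>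
      measurable_potentialOutcome x I i (measurableSet_singleton (x i))
  have := ae_all_iff.2 fun v => ae_potentialOutcome_eq D (p := p) (q := q) (v := v) hs fun z hz =>
    singleEdgeSchedule_consistent D hpq z I I' x hz v
  filter_upwards [this] with ω hω h v
  exact hω v h

theorem isCausalMarkov_singleEdgeLaw : IsCausalMarkov (singleEdgeLaw D p q) D := by
  classical
  constructor
  · intro v I x
    filter_upwards [ae_potentialOutcome_eq D MeasurableSet.univ fun z _ =>
      singleEdgeSchedule_exclusion D z v I x] with ω hω
    exact hω trivial
  · intro x
    rw [iIndepFun_of_measurePreserving (measurePreserving_singleEdgeSchedule D)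
      fun v => measurable_potentialOutcome x _ v]
    -- Once all parents are fixed by `x`, whether `v` is flipped depends on the selected pair only,
    -- not on the coins.
    have h := (iIndepFun_xor_fairCoin (PMF.uniformOfFintype (EdgeChoice V)).toMeasure
      fun v e => decide (∃ a, e = some (a, v) ∧ D.dir a v ∧ x a = p a)).comp
      (fun v b => if b then p v else q v) fun v => measurable_of_countable _
    rw [edgeCoinMeasure]
    convert h using 1
    funext v z
    have : IsFlipped D p z ⟨D.toPDAG.parents v, fun i => x i⟩ v ↔
        ∃ a, z.1 = some (a, v) ∧ D.dir a v ∧ x a = p a :=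
      exists_congr fun a => and_congr_right fun _ => and_congr_right fun h =>
        currentBit_of_mem h
    simp only [Function.comp_apply, potentialOutcome, singleEdgeSchedule, this]

theorem singleEdgeLaw_mem_dagModel (hpq : ∀ v, p v ≠ q v) :
    singleEdgeLaw D p q ∈ dagModel 𝒳 D :=
  ⟨⟨Measure.isProbabilityMeasure_map (measurable_singleEdgeSchedule D).aemeasurable,
    isConsistent_singleEdgeLaw D hpq⟩, isCausalMarkov_singleEdgeLaw D⟩

end SingleEdge

theorem proposition4p8 {V : Type u} [Finite V] (𝒳 : V → Type w)
    [∀ v, MeasurableSpace (𝒳 v)] [∀ v, MeasurableSingletonClass (𝒳 v)] [∀ v, Nontrivial (𝒳 v)]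
    (G₁ G₂ : PDAG V) (hG₁ : G₁.IsMPDAG) (hG₂ : G₂.IsMPDAG) :
    mpdagModel 𝒳 G₁ ⊆ mpdagModel 𝒳 G₂ ↔
      ∀ D₁ : DAG V, G₁.Represents D₁ →
        ∃ D₂ : DAG V, G₂.Represents D₂ ∧ D₁.toPDAG.IsSubgraph D₂.toPDAG := by
  constructor
  · intro h D₁ hD₁
    have := Fintype.ofFinite V
    choose p q hpq using fun v => exists_pair_ne (𝒳 v)
    obtain ⟨D₂, hD₂, hP⟩ :=
      Set.mem_iUnion₂.1 (h (Set.mem_iUnion₂.2 ⟨D₁, hD₁, singleEdgeLaw_mem_dagModel D₁ hpq⟩))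
    exact ⟨D₂, hD₂, isSubgraph_of_isCausalMarkov_singleEdgeLaw D₁ hpq hP.2⟩
  · intro h P hP
    obtain ⟨D₁, hD₁, hP⟩ := Set.mem_iUnion₂.1 hP
    obtain ⟨D₂, hD₂, hsub⟩ := h D₁ hD₁
    exact Set.mem_iUnion₂.2 ⟨D₂, hD₂, dagModel_mono hsub hP⟩
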